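/- Let $d\ge 1$, let $A\in\mathbb{R}^{d\times d}$ be symmetric with smallest and largest eigenvalues $\lambda_{\min}$ and $\lambda_{\max}$, let $b\in\mathbb{R}^d$, $R\ge 0$ and $\rho\ge 0$, and write $$f_{A,b}(x)=\tfrac12 x^TAx+b^Tx,\qquad f_{A,b,\rho}(x)=f_{A,b}(x)+\tfrac{\rho}{3}\|x\|^3 .$$ Let $s_{\mathrm{tr}}\in\operatorname{argmin}_{\|x\|\le R}f_{A,b}(x)$ and $s_{\mathrm{cr}}\in\operatorname{argmin}_{x\in\mathbb{R}^d}f_{A,b,\rho}(x)$ be global solutions of the trust-region and cubic-regularized problems. For $u\in\mathbb{R}^d$ and $t\ge 1$ let $$\mathcal{K}_t(A,\{b,u\})=\operatorname{span}\{b,Ab,\dots,A^{t-1}b,\,u,Au,\dots,A^{t-1}u\},$$ and let $$\hat x^{\mathrm{tr}}_t\in\operatorname*{argmin}_{x\in\mathcal{K}_t(A,\{b,u\}),\ \|x\|\le R}f_{A,b}(x),\qquad \hat x^{\mathrm{cr}}_t\in\operatorname*{argmin}_{x\in\mathcal{K}_t(A,\{b,u\})}f_{A,b,\rho}(x).$$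 Let $0<\delta<1$ and let $u$ be uniformly distributed on the unit sphere of $\mathbb{R}^d$. Then with probability at least $1-\delta$ over the choice of $u$, simultaneously for all integers $t\ge 1$ (and all choices of the minimizers above, whenever they exist), $$f_{A,b}(\hat x^{\mathrm{tr}}_t)-f_{A,b}(s_{\mathrm{tr}})\le\frac{(\lambda_{\max}-\lambda_{\min})R^2}{t^2}\left[4+\frac{\mathbf{1}_{\{\lambda_{\min}<0\}}}{2}\log^2\!\left(\frac{4d}{\delta^2}\right)\right]$$ and $$f_{A,b,\rho}(\hat x^{\mathrm{cr}}_t)-f_{A,b,\rho}(s_{\mathrm{cr}})\le\frac{(\lambda_{\max}-\lambda_{\min})\|s_{\mathrm{cr}}\|^2}{t^2}\left[4+\frac{\mathbf{1}_{\{\lambda_{\min}<0\}}}{2}\log^2\!\left(\frac{4d}{\delta^2}\right)\right].$$ No assumption is made on $b$; in particular the hard case, in which $b$ is orthogonal to an eigenvector of $\lambda_{\min}$, is included. -/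

import Mathlib

namespace KrylovJoint

noncomputable section

/-- The quadratic objective `f_{A,b}(x) = (1/2) xᵀ A x + bᵀ x` on `ℝᵈ` with its Euclidean
structure. -/
def quadObj {d : ℕ} (A : Matrix (Fin d) (Fin d) ℝ) (b x : EuclideanSpace ℝ (Fin d)) : ℝ :=
  1 / 2 * inner ℝ x (A.toEuclideanLin x) + inner ℝ b x

/-- The cubic-regularized objective `f_{A,b,ρ}(x) = f_{A,b}(x) + (ρ / 3) ‖x‖³`. -/
def cubicObj {d : ℕ} (A : Matrix (Fin d) (Fin d) ℝ) (b : EuclideanSpace ℝ (Fin d)) (ρ : ℝ)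
    (x : EuclideanSpace ℝ (Fin d)) : ℝ :=
  quadObj A b x + ρ / 3 * ‖x‖ ^ 3

/-- `x` is a (global) minimizer of `f` over the feasible set `S`, i.e. `x ∈ argmin_{y ∈ S} f y`. -/
def IsArgmin {X : Type*} (f : X → ℝ) (S : Set X) (x : X) : Prop :=
  x ∈ S ∧ ∀ y ∈ S, f x ≤ f y

/-- The joint Krylov subspace
`K_t(A, {b, u}) = span {b, A b, …, A^{t-1} b, u, A u, …, A^{t-1} u}`. -/
def jointKrylov {d : ℕ} (A : Matrix (Fin d) (Fin d) ℝ) (b u : EuclideanSpace ℝ (Fin d)) (t : ℕ) :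
    Submodule ℝ (EuclideanSpace ℝ (Fin d)) :=
  Submodule.span ℝ
    ({w | ∃ k < t, w = (A ^ k).toEuclideanLin b} ∪ {w | ∃ k < t, w = (A ^ k).toEuclideanLin u})

/-- The smallest eigenvalue of a symmetric matrix (of size at least one). -/
def lamMin {d : ℕ} {A : Matrix (Fin d) (Fin d) ℝ} (hA : A.IsHermitian) : ℝ :=
  ⨅ i, hA.eigenvalues i

/-- The largest eigenvalue of a symmetric matrix (of size at least one). -/
def lamMax {d : ℕ} {A : Matrix (Fin d) (Fin d) ℝ} (hA : A.IsHermitian) : ℝ :=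
  ⨆ i, hA.eigenvalues i

/-- The uniform distribution on the unit sphere of `ℝᵈ`: the normalized surface measure. -/
def uniformSphere (d : ℕ) :
    MeasureTheory.Measure (Metric.sphere (0 : EuclideanSpace ℝ (Fin d)) 1) :=
  ((MeasureTheory.volume : MeasureTheory.Measure (EuclideanSpace ℝ (Fin d))).toSphere Set.univ)⁻¹ •
    (MeasureTheory.volume : MeasureTheory.Measure (EuclideanSpace ℝ (Fin d))).toSphere

/-- The bracket `4 + (1_{λ_min < 0} / 2) log² (4 d / δ²)`. -/
def logFactor {d : ℕ} {A : Matrix (Fin d) (Fin d) ℝ} (hA : A.IsHermitian) (δ : ℝ) : ℝ :=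
  4 + (if lamMin hA < 0 then (1 : ℝ) else 0) / 2 * Real.log (4 * (d : ℝ) / δ ^ 2) ^ 2

end

end KrylovJoint

/-! Put `H = A - λ_min I`, so that `0 ≤ H ≤ L` for any `L > 0` with `L ≥ λ_max - λ_min`, and the
objective is a convex quadratic in `H` plus `(λ_min / 2) ‖x‖²`. If `λ_min ≥ 0`, the accelerated
proximal gradient method started at `0` gives the term `4`. Projecting onto a centred ball is a
scaling, so its `t`-th iterate stays in the Krylov space (`exists_accelerated_iterate`).

If `λ_min < 0`, a trust-region solution also minimizes the convex part over the ball: `H`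
annihilates a bottom eigenvector `v`, so every point can be pushed along `±v` to the sphere without
increasing the convex part. Acceleration gives a nearly optimal `y` for that part. It is then moved
to the sphere along a unit vector `z` of the Krylov space, with the sign that makes the first-order
change nonpositive, at a cost of at most `(1/2) (2R)² ⟪z, H z⟫`. The hard case needs no separate
treatment.

The vector `z` is an odd Chebyshev filter applied to `u` (`exists_small_rayleigh`). It needs only
`⟪v, u⟫² ≥ δ² / d`, the sole random event, which does not depend on `t`
(`uniformSphere_inner_sq_lt_le`). The cubic problem reduces to the trust region of radius `‖s_cr‖`.
-/

namespace KrylovJoint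

/-! ### Accelerated proximal gradient on a centred ball -/

section Acceleration

variable {V : Type*} [NormedAddCommGroup V] [InnerProductSpace ℝ V]

/-- The quadratic `x ↦ (1/2) ⟪x, H x⟫ + ⟪b, x⟫` of a linear operator `H`. -/
noncomputable def opQuad (H : V →ₗ[ℝ] V) (b x : V) : ℝ :=
  1 / 2 * inner ℝ x (H x) + inner ℝ b x

theorem opQuad_add {H : V →ₗ[ℝ] V} (hH : H.IsSymmetric) (b y h : V) :
    opQuad H b (y + h) =
      opQuad H b y + inner ℝ (H y + b) h + 1 / 2 * inner ℝ h (H h) := by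
  have h1 : inner ℝ h (H y) = inner ℝ y (H h) := by
    rw [← hH, real_inner_comm]
  have h2 : inner ℝ (H y) h = inner ℝ y (H h) := hH y h
  simp only [opQuad, map_add, inner_add_left, inner_add_right, h1, h2]
  ring

/-- The projection onto a centred ball is a scaling, and satisfies the obtuse angle inequality. -/
theorem exists_smul_proj_ball (q : V) {R : ℝ} (hR : 0 ≤ R) :
    ∃ a : ℝ, ‖a • q‖ ≤ R ∧ ∀ w : V, ‖w‖ ≤ R → inner ℝ (q - a • q) (w - a • q) ≤ 0 := by
  rcases le_or_gt ‖q‖ R with h | h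
  · exact ⟨1, by simpa using h, fun w _ => by simp⟩
  · have hq : 0 < ‖q‖ := hR.trans_lt h
    refine ⟨R / ‖q‖, ?_, fun w hw => ?_⟩
    · rw [norm_smul, Real.norm_of_nonneg (by positivity)]
      field_simp
      rfl
    · have h1 : q - (R / ‖q‖) • q = (1 - R / ‖q‖) • q := by rw [sub_smul, one_smul]
      have h2 : 0 ≤ 1 - R / ‖q‖ := by
        rw [sub_nonneg, div_le_one hq]; exact h.le
      rw [h1, inner_smul_left, inner_sub_right, inner_smul_right, real_inner_self_eq_norm_sq]
      have h3 : inner ℝ q w ≤ ‖q‖ * R :=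
        (real_inner_le_norm q w).trans (by gcongr)
      have h4 : R / ‖q‖ * ‖q‖ ^ 2 = ‖q‖ * R := by field_simp
      rw [h4]
      exact mul_nonpos_of_nonneg_of_nonpos h2 (by linarith)

/-- One step of the accelerated proximal gradient method for
`x ↦ opQuad H b x + c / 2 * ‖x‖ ^ 2` over a centred ball. -/
theorem exists_accelerated_step {H : V →ₗ[ℝ] V} (hH : H.IsSymmetric) {L c R θ : ℝ}
    (hH0 : ∀ x, 0 ≤ inner ℝ x (H x)) (hHL : ∀ x, inner ℝ x (H x) ≤ L * ‖x‖ ^ 2)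
    (hL : 0 < L) (hc : 0 ≤ c) (hR : 0 ≤ R) (hθ : 0 < θ) (hθ1 : θ ≤ 1) (b x z w : V)
    (hw : ‖w‖ ≤ R) :
    ∃ α β : ℝ, ∃ z' x' : V, z' = α • z + β • (H ((1 - θ) • x + θ • z) + b) ∧
      x' = (1 - θ) • x + θ • z' ∧ ‖z'‖ ≤ R ∧
      opQuad H b x' + c / 2 * ‖x'‖ ^ 2 + L * θ ^ 2 / 2 * ‖w - z'‖ ^ 2 ≤
        (1 - θ) * (opQuad H b x + c / 2 * ‖x‖ ^ 2) + θ * (opQuad H b w + c / 2 * ‖w‖ ^ 2) +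
          L * θ ^ 2 / 2 * ‖w - z‖ ^ 2 := by
  set y := (1 - θ) • x + θ • z with hy
  set G := H y + b with hG
  have hk : 0 < L * θ + c := by positivity
  obtain ⟨a, ha1, ha2⟩ := exists_smul_proj_ball ((L * θ + c)⁻¹ • ((L * θ) • z - G)) hR
  -- The unconstrained minimizer of `⟪G, ·⟫ + c/2 ‖·‖² + Lθ/2 ‖· - z‖²`, projected onto the ball.
  -- This model is isotropic, so the projection is its constrained minimizer.
  set z' := a • (L * θ + c)⁻¹ • ((L * θ) • z - G) with hz'
  refine ⟨a * (L * θ + c)⁻¹ * (L * θ), -(a * (L * θ + c)⁻¹), z', (1 - θ) • x + θ • z', ?_, rfl,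
    ha1, ?_⟩
  · rw [hz']; module
  set x' := (1 - θ) • x + θ • z' with hx'
  have hprox : inner ℝ ((L * θ) • z - G - (L * θ + c) • z') (w - z') ≤ 0 := by
    have h := ha2 w hw
    have e : (L * θ) • z - G - (L * θ + c) • z' =
        (L * θ + c) • ((L * θ + c)⁻¹ • ((L * θ) • z - G) - z') := by
      rw [smul_sub, smul_inv_smul₀ hk.ne']
    rw [e, inner_smul_left]
    exact mul_nonpos_of_nonneg_of_nonpos hk.le h
  have e1 : x' - y = θ • (z' - z) := by rw [hx', hy]; module
  have e2 : x' = y + θ • (z' - z) := by rw [← e1]; abel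
  have q1 := opQuad_add hH b y (θ • (z' - z))
  rw [← e2, ← hG] at q1
  have q2 := opQuad_add hH b y (x - y)
  have q3 := opQuad_add hH b y (w - y)
  rw [add_sub_cancel, ← hG] at q2 q3
  have p1 := hHL (θ • (z' - z))
  have p2 := hH0 (x - y)
  have p3 := hH0 (w - y)
  have n1 : ‖θ • (z' - z)‖ ^ 2 = θ ^ 2 * ‖z' - z‖ ^ 2 := by
    rw [norm_smul, mul_pow, Real.norm_eq_abs, sq_abs]
  have n2 : ‖x'‖ ^ 2 = (1 - θ) * ‖x‖ ^ 2 + θ * ‖z'‖ ^ 2 - θ * (1 - θ) * ‖x - z'‖ ^ 2 := by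
    simp only [← real_inner_self_eq_norm_sq, hx', inner_add_left, inner_add_right, inner_sub_left,
      inner_sub_right, inner_smul_left, inner_smul_right, real_inner_comm x z']
    simp
    ring
  have n3 : 0 ≤ θ * (1 - θ) * ‖x - z'‖ ^ 2 := by
    have : 0 ≤ 1 - θ := by linarith
    positivity
  have n4 : inner ℝ G (θ • (z' - z)) =
      (1 - θ) * inner ℝ G (x - y) + θ * inner ℝ G (w - y) + θ * inner ℝ G (z' - w) := by
    rw [← inner_smul_right, ← inner_smul_right, ← inner_smul_right, ← inner_add_right,
      ← inner_add_right]
    congr 1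
    rw [hy]; module
  have n5 : inner ℝ G (z' - w) = inner ℝ ((L * θ) • z - G - (L * θ + c) • z') (w - z') +
      L * θ / 2 * (‖w - z‖ ^ 2 - ‖w - z'‖ ^ 2 - ‖z' - z‖ ^ 2) +
      c / 2 * (‖w‖ ^ 2 - ‖z'‖ ^ 2 - ‖w - z'‖ ^ 2) := by
    simp only [← real_inner_self_eq_norm_sq, inner_sub_left,
      inner_sub_right, inner_smul_left, real_inner_comm w z', real_inner_comm w z,
      real_inner_comm z z']
    simp
    ring
  have n6 : 0 ≤ c / 2 * ‖w - z'‖ ^ 2 := by positivity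
  have m1 : θ * inner ℝ G (z' - w) ≤ θ * (L * θ / 2 * (‖w - z‖ ^ 2 - ‖w - z'‖ ^ 2 - ‖z' - z‖ ^ 2) +
      c / 2 * (‖w‖ ^ 2 - ‖z'‖ ^ 2)) :=
    mul_le_mul_of_nonneg_left (by linarith) hθ.le
  have m2 : (1 - θ) * (opQuad H b y + inner ℝ G (x - y)) ≤ (1 - θ) * opQuad H b x :=
    mul_le_mul_of_nonneg_left (by linarith) (by linarith)
  have m3 : θ * (opQuad H b y + inner ℝ G (w - y)) ≤ θ * opQuad H b w :=
    mul_le_mul_of_nonneg_left (by linarith) hθ.le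
  have m4 : c / 2 * ‖x'‖ ^ 2 ≤ c / 2 * ((1 - θ) * ‖x‖ ^ 2 + θ * ‖z'‖ ^ 2) :=
    mul_le_mul_of_nonneg_left (by linarith) (by positivity)
  rw [q1, n4]
  rw [n1] at p1
  linarith

/-- The accelerated method over an increasing family of subspaces closed under `H` up to a shift. -/
theorem exists_accelerated_iterate {H : V →ₗ[ℝ] V} (hH : H.IsSymmetric) {L c R : ℝ}
    (hH0 : ∀ x, 0 ≤ inner ℝ x (H x)) (hHL : ∀ x, inner ℝ x (H x) ≤ L * ‖x‖ ^ 2)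
    (hL : 0 < L) (hc : 0 ≤ c) (hR : 0 ≤ R) (b w : V) (K : ℕ → Submodule ℝ V)
    (hKmono : ∀ k, K k ≤ K (k + 1)) (hKb : ∀ k, b ∈ K (k + 1))
    (hKH : ∀ k, ∀ x ∈ K k, H x ∈ K (k + 1)) (hw : ‖w‖ ≤ R)
    (hmin : ∀ x, ‖x‖ ≤ R →
      opQuad H b w + c / 2 * ‖w‖ ^ 2 ≤ opQuad H b x + c / 2 * ‖x‖ ^ 2) (k : ℕ) :
    ∃ x ∈ K k, ∃ z ∈ K k, ‖x‖ ≤ R ∧ ‖z‖ ≤ R ∧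
      (k : ℝ) * (k + 2) / 4 * (opQuad H b x + c / 2 * ‖x‖ ^ 2 -
        (opQuad H b w + c / 2 * ‖w‖ ^ 2)) + L / 2 * ‖w - z‖ ^ 2 ≤ L / 2 * ‖w‖ ^ 2 := by
  induction k with
  | zero => exact ⟨0, zero_mem _, 0, zero_mem _, by simpa, by simpa, by simp⟩
  | succ k ih =>
    obtain ⟨x, hx, z, hz, hxR, hzR, h⟩ := ih
    have hk : (0 : ℝ) < (k : ℝ) + 2 := by positivity
    have hθ1 : 2 / ((k : ℝ) + 2) ≤ 1 := by
      rw [div_le_one hk]; linarith [(Nat.cast_nonneg k : (0 : ℝ) ≤ k)]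
    -- With this `θ`, `(k+2)²/4 * θ² = 1` and `(k+2)²/4 * (1 - θ) = k(k+2)/4`, so the scaled step
    -- inequality telescopes.
    set θ : ℝ := 2 / ((k : ℝ) + 2) with hθ
    have hθ0 : 0 < θ := by positivity
    obtain ⟨α, β, z', x', hz', hx', hz'R, hstep⟩ :=
      exists_accelerated_step hH hH0 hHL hL hc hR hθ0 hθ1 b x z w hw
    have hz'K : z' ∈ K (k + 1) := by
      rw [hz']
      refine add_mem (Submodule.smul_mem _ _ (hKmono _ hz)) (Submodule.smul_mem _ _ (add_mem
        (hKH k _ (add_mem (Submodule.smul_mem _ _ hx) (Submodule.smul_mem _ _ hz))) (hKb k)))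
    have hx'R : ‖x'‖ ≤ R := by
      rw [hx']
      refine (norm_add_le _ _).trans ?_
      rw [norm_smul, norm_smul, Real.norm_of_nonneg (by linarith), Real.norm_of_nonneg hθ0.le]
      calc (1 - θ) * ‖x‖ + θ * ‖z'‖ ≤ (1 - θ) * R + θ * R := by
            gcongr
        _ = R := by ring
    refine ⟨x', ?_, z', hz'K, hx'R, hz'R, ?_⟩
    · rw [hx']
      exact add_mem (Submodule.smul_mem _ _ (hKmono _ hx)) (Submodule.smul_mem _ _ hz'K)
    set F := opQuad H b x + c / 2 * ‖x‖ ^ 2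
    set F' := opQuad H b x' + c / 2 * ‖x'‖ ^ 2
    set Fw := opQuad H b w + c / 2 * ‖w‖ ^ 2
    have he : 0 ≤ F' - Fw := sub_nonneg.2 (hmin x' hx'R)
    have h1 : ((k : ℝ) + 2) ^ 2 / 4 * (F' - Fw) + L / 2 * ‖w - z'‖ ^ 2 ≤
        (k : ℝ) * (k + 2) / 4 * (F - Fw) + L / 2 * ‖w - z‖ ^ 2 := by
      have h2 := mul_le_mul_of_nonneg_left hstep (by positivity : 0 ≤ ((k : ℝ) + 2) ^ 2 / 4)
      have t1 : ((k : ℝ) + 2) ^ 2 / 4 * θ ^ 2 = 1 := by rw [hθ]; field_simp; norm_num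
      have t2 : ((k : ℝ) + 2) ^ 2 / 4 * θ = (k + 2) / 2 := by rw [hθ]; field_simp; norm_num
      have h3 : ((k : ℝ) + 2) ^ 2 / 4 * (F' + L * θ ^ 2 / 2 * ‖w - z'‖ ^ 2) =
          ((k : ℝ) + 2) ^ 2 / 4 * F' + L / 2 * ‖w - z'‖ ^ 2 := by
        linear_combination (L / 2 * ‖w - z'‖ ^ 2) * t1
      have h4 : ((k : ℝ) + 2) ^ 2 / 4 * ((1 - θ) * F + θ * Fw + L * θ ^ 2 / 2 * ‖w - z‖ ^ 2) =
          ((k : ℝ) + 2) ^ 2 / 4 * F + (k + 2) / 2 * (Fw - F) + L / 2 * ‖w - z‖ ^ 2 := by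
        linear_combination (L / 2 * ‖w - z‖ ^ 2) * t1 + (Fw - F) * t2
      rw [h3, h4] at h2
      linarith
    push_cast
    have h5 : ((k : ℝ) + 1) * (k + 1 + 2) / 4 * (F' - Fw) ≤ ((k : ℝ) + 2) ^ 2 / 4 * (F' - Fw) := by
      refine mul_le_mul_of_nonneg_right ?_ he
      linarith [sq_nonneg (k : ℝ)]
    linarith

end Acceleration

/-! ### Joint Krylov subspaces -/

theorem jointKrylov_mono {d : ℕ} (A : Matrix (Fin d) (Fin d) ℝ) (b u : EuclideanSpace ℝ (Fin d)) :
    Monotone (jointKrylov A b u) := by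
  intro s t hst
  refine Submodule.span_mono (Set.union_subset_union ?_ ?_) <;>
  · rintro w ⟨k, hk, rfl⟩
    exact ⟨k, hk.trans_le hst, rfl⟩

theorem left_mem_jointKrylov {d : ℕ} (A : Matrix (Fin d) (Fin d) ℝ)
    (b u : EuclideanSpace ℝ (Fin d)) (k : ℕ) : b ∈ jointKrylov A b u (k + 1) :=
  Submodule.subset_span (Or.inl ⟨0, k.succ_pos, by simp⟩)

theorem right_mem_jointKrylov {d : ℕ} (A : Matrix (Fin d) (Fin d) ℝ)
    (b u : EuclideanSpace ℝ (Fin d)) (k : ℕ) : u ∈ jointKrylov A b u (k + 1) :=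
  Submodule.subset_span (Or.inr ⟨0, k.succ_pos, by simp⟩)

theorem toEuclideanLin_mem_jointKrylov {d : ℕ} (A : Matrix (Fin d) (Fin d) ℝ)
    (b u : EuclideanSpace ℝ (Fin d)) (k : ℕ) {x : EuclideanSpace ℝ (Fin d)}
    (hx : x ∈ jointKrylov A b u k) : A.toEuclideanLin x ∈ jointKrylov A b u (k + 1) := by
  have hpow : ∀ (j : ℕ) (y : EuclideanSpace ℝ (Fin d)),
      A.toEuclideanLin ((A ^ j).toEuclideanLin y) = (A ^ (j + 1)).toEuclideanLin y := by
    intro j y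
    ext i
    simp [Matrix.toLpLin_apply, pow_succ']
  have h : jointKrylov A b u k ≤ (jointKrylov A b u (k + 1)).comap A.toEuclideanLin := by
    refine Submodule.span_le.2 ?_
    rintro w (⟨j, hj, rfl⟩ | ⟨j, hj, rfl⟩)
    · exact Submodule.subset_span (Or.inl ⟨j + 1, by omega, hpow j b⟩)
    · exact Submodule.subset_span (Or.inr ⟨j + 1, by omega, hpow j u⟩)
  exact h hx

end KrylovJoint

/-! ### Odd Chebyshev polynomials -/

namespace KrylovJoint

/-- The polynomials `Pₙ` with `T_{2n+1}(y) = y * Pₙ(y ^ 2)`, where `T` denotes the Chebyshev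
polynomials of the first kind. -/
noncomputable def oddChebyshev : ℕ → ℝ → ℝ
  | 0, _ => 1
  | 1, w => 4 * w - 3
  | n + 2, w => (4 * w - 2) * oddChebyshev (n + 1) w - oddChebyshev n w

theorem cos_mul_oddChebyshev (φ : ℝ) (n : ℕ) :
    Real.cos φ * oddChebyshev n (Real.cos φ ^ 2) = Real.cos ((2 * n + 1) * φ) := by
  induction n using Nat.twoStepInduction with
  | zero => simp [oddChebyshev]
  | one =>
    have : (2 * ((1 : ℕ) : ℝ) + 1) * φ = 3 * φ := by push_cast; ring
    rw [this, Real.cos_three_mul, oddChebyshev]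
    ring
  | more n ih0 ih1 =>
    rw [oddChebyshev, mul_sub, ih0, mul_left_comm, ih1]
    have e1 : (2 * ((n + 2 : ℕ) : ℝ) + 1) * φ = (2 * ((n + 1 : ℕ) : ℝ) + 1) * φ + 2 * φ := by
      push_cast; ring
    have e2 : (2 * (n : ℝ) + 1) * φ = (2 * ((n + 1 : ℕ) : ℝ) + 1) * φ - 2 * φ := by
      push_cast; ring
    rw [e1, e2, Real.cos_add, Real.cos_sub, Real.cos_two_mul]
    ring

/-- The cosine identity at the imaginary point `y = i sinh θ`; it gives the growth of the filter at
negative arguments. -/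
theorem sinh_mul_oddChebyshev (θ : ℝ) (n : ℕ) :
    Real.sinh θ * oddChebyshev n (-Real.sinh θ ^ 2) = (-1) ^ n * Real.sinh ((2 * n + 1) * θ) := by
  induction n using Nat.twoStepInduction with
  | zero => simp [oddChebyshev]
  | one =>
    have : (2 * ((1 : ℕ) : ℝ) + 1) * θ = 3 * θ := by push_cast; ring
    rw [this, Real.sinh_three_mul, oddChebyshev]
    ring
  | more n ih0 ih1 =>
    rw [oddChebyshev, mul_sub, ih0, mul_left_comm, ih1]
    have e1 : (2 * ((n + 2 : ℕ) : ℝ) + 1) * θ = (2 * ((n + 1 : ℕ) : ℝ) + 1) * θ + 2 * θ := by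
      push_cast; ring
    have e2 : (2 * (n : ℝ) + 1) * θ = (2 * ((n + 1 : ℕ) : ℝ) + 1) * θ - 2 * θ := by
      push_cast; ring
    rw [e1, e2, Real.sinh_add, Real.sinh_sub, Real.cosh_two_mul, Real.cosh_sq]
    ring

/-- For `w = y²` the left side is `T_{2n+1}(y)²`, while for `w ≤ 0` the sign suffices. Hence no
lower bound on `w` is needed. -/
theorem mul_oddChebyshev_sq_le_one (n : ℕ) {w : ℝ} (hw : w ≤ 1) :
    w * oddChebyshev n w ^ 2 ≤ 1 := by
  rcases le_or_gt w 0 with h | h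
  · exact (mul_nonpos_of_nonpos_of_nonneg h (sq_nonneg _)).trans zero_le_one
  · have h1 : √w ≤ 1 := Real.sqrt_le_one.2 hw
    have h2 : Real.cos (Real.arccos √w) = √w :=
      Real.cos_arccos (by linarith [Real.sqrt_nonneg w]) h1
    have h3 := cos_mul_oddChebyshev (Real.arccos √w) n
    rw [h2, Real.sq_sqrt h.le] at h3
    have h4 : w * oddChebyshev n w ^ 2 = (√w * oddChebyshev n w) ^ 2 := by
      rw [mul_pow, Real.sq_sqrt h.le]
    rw [h4, h3]
    exact Real.cos_sq_le_one _

/-- Equivalent to `tanh θ ≤ θ`, which turns the Rayleigh bound `L tanh² θ` into `L θ²`. -/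
theorem sinh_le_mul_cosh {θ : ℝ} (hθ : 0 ≤ θ) : Real.sinh θ ≤ θ * Real.cosh θ := by
  have hd : ∀ x : ℝ, HasDerivAt (fun x => x * Real.cosh x - Real.sinh x) (x * Real.sinh x) x := by
    intro x
    refine (((hasDerivAt_id' x).mul (Real.hasDerivAt_cosh x)).sub
      (Real.hasDerivAt_sinh x)).congr_deriv ?_
    ring
  have hm : MonotoneOn (fun x => x * Real.cosh x - Real.sinh x) (Set.Ici 0) := by
    refine monotoneOn_of_deriv_nonneg (convex_Ici 0)
      (fun x _ => (hd x).continuousAt.continuousWithinAt)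
      (fun x _ => (hd x).differentiableAt.differentiableWithinAt) ?_
    intro x hx
    rw [interior_Ici, Set.mem_Ioi] at hx
    rw [(hd x).deriv]
    exact mul_nonneg hx.le (Real.sinh_nonneg_iff.2 hx.le)
  have := hm (Set.mem_Ici.2 le_rfl) (Set.mem_Ici.2 hθ) hθ
  simp only [Real.sinh_zero, sub_zero, zero_mul] at this
  linarith

/-! ### Small Rayleigh quotients in Krylov subspaces -/

section Lanczos

variable {V ι : Type*} [NormedAddCommGroup V] [InnerProductSpace ℝ V] [Fintype ι]

theorem inner_apply_eq_sum (v : OrthonormalBasis ι ℝ V) {H : V →ₗ[ℝ] V} (hH : H.IsSymmetric)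
    {μ : ι → ℝ} (hμ : ∀ i, H (v i) = μ i • v i) (x : V) :
    inner ℝ x (H x) = ∑ i, μ i * inner ℝ (v i) x ^ 2 := by
  rw [← v.sum_inner_mul_inner]
  refine Finset.sum_congr rfl fun i _ => ?_
  rw [← hH, hμ, inner_smul_left, real_inner_comm x]
  simp
  ring

theorem norm_sq_eq_sum (v : OrthonormalBasis ι ℝ V) (x : V) :
    ‖x‖ ^ 2 = ∑ i, inner ℝ (v i) x ^ 2 := by
  simp [← v.sum_sq_norm_inner_right]

/-- Affine images of a diagonalizable operator may be substituted into `oddChebyshev n` inside an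
increasing family of subspaces on which the operator has degree one. -/
theorem exists_oddChebyshev_vector (v : OrthonormalBasis ι ℝ V) {H : V →ₗ[ℝ] V}
    (hH : H.IsSymmetric) {μ : ι → ℝ} (hμ : ∀ i, H (v i) = μ i • v i) (u : V)
    (K : ℕ → Submodule ℝ V) (hKmono : ∀ k, K k ≤ K (k + 1)) (hKu : u ∈ K 1)
    (hKH : ∀ k, ∀ x ∈ K k, H x ∈ K (k + 1)) (α β : ℝ) (n : ℕ) :
    ∃ z ∈ K (n + 1), ∀ i, inner ℝ (v i) z = oddChebyshev n (α * μ i + β) * inner ℝ (v i) u := by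
  have hin : ∀ i x, inner ℝ (v i) (H x) = μ i * inner ℝ (v i) x := by
    intro i x
    rw [← hH, hμ, inner_smul_left]
    simp
  induction n using Nat.twoStepInduction with
  | zero => exact ⟨u, hKu, by simp [oddChebyshev]⟩
  | one =>
    refine ⟨(4 * α) • H u + (4 * β - 3) • u, add_mem (Submodule.smul_mem _ _ (hKH 1 u hKu))
      (Submodule.smul_mem _ _ (hKmono 1 hKu)), fun i => ?_⟩
    rw [inner_add_right, inner_smul_right, inner_smul_right, hin, oddChebyshev]
    ring
  | more n ih0 ih1 =>
    obtain ⟨x, hx, hx'⟩ := ih0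
    obtain ⟨y, hy, hy'⟩ := ih1
    refine ⟨(4 * α) • H y + (4 * β - 2) • y - x, sub_mem (add_mem
      (Submodule.smul_mem _ _ (hKH _ y hy)) (Submodule.smul_mem _ _ (hKmono _ hy)))
      (hKmono _ (hKmono _ hx)), fun i => ?_⟩
    rw [inner_sub_right, inner_add_right, inner_smul_right, inner_smul_right, hin, hx', hy',
      oddChebyshev]
    ring

/-- A Krylov subspace generated by `u` contains a unit vector of small Rayleigh quotient. -/
theorem exists_small_rayleigh (v : OrthonormalBasis ι ℝ V) {H : V →ₗ[ℝ] V}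
    (hH : H.IsSymmetric) {μ : ι → ℝ} (hμ : ∀ i, H (v i) = μ i • v i) {L κ : ℝ} (hL : 0 < L)
    (hμL : ∀ i, μ i ≤ L) {i₀ : ι} (hi₀ : μ i₀ = 0) {u : V} (hu : ‖u‖ = 1)
    (hκ : 0 < κ) (hκu : κ ≤ inner ℝ (v i₀) u ^ 2)
    (K : ℕ → Submodule ℝ V) (hKmono : ∀ k, K k ≤ K (k + 1)) (hKu : u ∈ K 1)
    (hKH : ∀ k, ∀ x ∈ K k, H x ∈ K (k + 1)) {t : ℕ} (ht : 1 ≤ t) :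
    ∃ z ∈ K t, ‖z‖ = 1 ∧ inner ℝ z (H z) ≤ L * Real.log (4 / κ) ^ 2 / (4 * t ^ 2) := by
  classical
  obtain ⟨n, rfl⟩ : ∃ n, t = n + 1 := ⟨t - 1, by omega⟩
  have hu1 : ∑ i, inner ℝ (v i) u ^ 2 = 1 := by rw [← norm_sq_eq_sum, hu, one_pow]
  have hκ1 : κ ≤ 1 := by
    rw [← hu1]
    exact hκu.trans (Finset.single_le_sum (f := fun i => inner ℝ (v i) u ^ 2)
      (fun i _ => sq_nonneg _) (Finset.mem_univ i₀))
  have hlog : 0 < Real.log (4 / κ) := by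
    apply Real.log_pos
    rw [lt_div_iff₀ hκ]
    linarith
  have hm : (0 : ℝ) < 2 * n + 1 := by positivity
  -- Chosen so that `exp((2n+1)θ)² = 4/κ`, whence `cosh((2n+1)θ)² κ ≥ 1`.
  set θ : ℝ := Real.log (4 / κ) / (2 * (2 * n + 1)) with hθ
  have hθ0 : 0 < θ := by positivity
  have hc1 : 0 < Real.cosh θ ^ 2 := by positivity
  obtain ⟨z, hz, hzi⟩ := exists_oddChebyshev_vector v hH hμ u K hKmono hKu hKH
    (Real.cosh θ ^ 2 / L) (-Real.sinh θ ^ 2) n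
  -- This affine map sends the eigenvalue `0` to `-sinh² θ`, `L tanh² θ` to `0` and `L` to `1`.
  set w : ι → ℝ := fun i => Real.cosh θ ^ 2 / L * μ i + -Real.sinh θ ^ 2 with hw
  have hw1 : ∀ i, w i ≤ 1 := by
    intro i
    have h1 : Real.cosh θ ^ 2 / L * μ i ≤ Real.cosh θ ^ 2 / L * L := by
      gcongr
      exact hμL i
    rw [div_mul_cancel₀ _ hL.ne', Real.cosh_sq] at h1
    simp only [hw, Real.cosh_sq]
    linarith
  have hw0 : w i₀ = -Real.sinh θ ^ 2 := by simp [hw, hi₀]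
  have hP0 := sinh_mul_oddChebyshev θ n
  -- The coordinate `i₀` contributes `-sinh²((2n+1)θ) ⟪v i₀, u⟫²`, and each other one at most `⟪v i,
  -- u⟫²`. As `‖u‖ = 1`, the total is at most `1 - cosh²((2n+1)θ) ⟪v i₀, u⟫² ≤ 0`.
  have hsum : ∑ i, w i * inner ℝ (v i) z ^ 2 ≤ 0 := by
    have hterm : ∀ i, w i * inner ℝ (v i) z ^ 2 ≤ inner ℝ (v i) u ^ 2 -
        (if i = i₀ then Real.cosh ((2 * n + 1) * θ) ^ 2 * inner ℝ (v i) u ^ 2 else 0) := by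
      intro i
      rw [hzi i, mul_pow, ← mul_assoc]
      split_ifs with h
      · have e1 : w i * oddChebyshev n (w i) ^ 2 = -Real.sinh ((2 * n + 1) * θ) ^ 2 := by
          rw [h, hw0]
          have : (Real.sinh θ * oddChebyshev n (-Real.sinh θ ^ 2)) ^ 2 =
              Real.sinh ((2 * n + 1) * θ) ^ 2 := by
            rw [hP0, mul_pow, ← pow_mul, mul_comm n 2, pow_mul]
            norm_num
          rw [← this]
          ring
        rw [e1, Real.cosh_sq]
        linarith
      · rw [sub_zero]
        exact mul_le_of_le_one_left (sq_nonneg _) (mul_oddChebyshev_sq_le_one n (hw1 i))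
    refine (Finset.sum_le_sum fun i _ => hterm i).trans ?_
    rw [Finset.sum_sub_distrib, hu1, Finset.sum_ite_eq' Finset.univ i₀, if_pos (Finset.mem_univ _),
      sub_nonpos]
    have h1 : Real.exp ((2 * n + 1) * θ) ^ 2 = 4 / κ := by
      rw [← Real.exp_nat_mul, ← Real.exp_log (show 0 < 4 / κ by positivity)]
      congr 1
      rw [hθ]
      push_cast
      field_simp
    have h2 : Real.exp ((2 * n + 1) * θ) / 2 ≤ Real.cosh ((2 * n + 1) * θ) := by
      rw [Real.cosh_eq]
      linarith [Real.exp_pos (-((2 * n + 1) * θ))]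
    calc (1 : ℝ) = (Real.exp ((2 * n + 1) * θ) / 2) ^ 2 * κ := by
          rw [div_pow, h1]
          field_simp
          norm_num
      _ ≤ Real.cosh ((2 * n + 1) * θ) ^ 2 * inner ℝ (v i₀) u ^ 2 := by gcongr
  have hquad : inner ℝ z (H z) ≤ L * θ ^ 2 * ‖z‖ ^ 2 := by
    have e1 : ∑ i, w i * inner ℝ (v i) z ^ 2 =
        Real.cosh θ ^ 2 / L * inner ℝ z (H z) - Real.sinh θ ^ 2 * ‖z‖ ^ 2 := by
      rw [inner_apply_eq_sum v hH hμ, norm_sq_eq_sum v, Finset.mul_sum, Finset.mul_sum,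
        ← Finset.sum_sub_distrib]
      refine Finset.sum_congr rfl fun i _ => ?_
      simp only [hw]
      ring
    rw [e1, sub_nonpos] at hsum
    have e2 : Real.sinh θ ^ 2 ≤ (θ * Real.cosh θ) ^ 2 :=
      pow_le_pow_left₀ (Real.sinh_nonneg_iff.2 hθ0.le) (sinh_le_mul_cosh hθ0.le) 2
    have e3 : Real.cosh θ ^ 2 / L * inner ℝ z (H z) ≤
        Real.cosh θ ^ 2 / L * (L * θ ^ 2 * ‖z‖ ^ 2) := by
      refine hsum.trans ((mul_le_mul_of_nonneg_right e2 (sq_nonneg _)).trans_eq ?_)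
      field_simp
    exact le_of_mul_le_mul_left e3 (by positivity)
  have hz0 : z ≠ 0 := by
    rintro rfl
    have h1 := hzi i₀
    rw [inner_zero_right] at h1
    have h2 : inner ℝ (v i₀) u ≠ 0 := by
      intro h
      rw [h] at hκu
      norm_num at hκu
      linarith
    have h3 : oddChebyshev n (-Real.sinh θ ^ 2) = 0 := by
      rw [← hw0]
      exact (mul_eq_zero.1 h1.symm).resolve_right h2
    rw [h3, mul_zero] at hP0
    have h4 : 0 < Real.sinh ((2 * n + 1) * θ) := Real.sinh_pos_iff.2 (by positivity)
    exact (mul_ne_zero (pow_ne_zero n (by norm_num)) h4.ne') hP0.symm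
  have hzn : 0 < ‖z‖ := norm_pos_iff.2 hz0
  refine ⟨‖z‖⁻¹ • z, Submodule.smul_mem _ _ hz, norm_smul_inv_norm (𝕜 := ℝ) hz0, ?_⟩
  rw [map_smul, inner_smul_left, inner_smul_right]
  calc ‖z‖⁻¹ * (‖z‖⁻¹ * inner ℝ z (H z)) ≤ ‖z‖⁻¹ * (‖z‖⁻¹ * (L * θ ^ 2 * ‖z‖ ^ 2)) := by gcongr
    _ = L * Real.log (4 / κ) ^ 2 / (4 * (2 * n + 1) ^ 2) := by
        rw [hθ]
        field_simp
        norm_num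
    -- A filter of degree `n` lives in `K (n + 1)`, and `2n + 1 ≥ n + 1 = t`.
    _ ≤ L * Real.log (4 / κ) ^ 2 / (4 * ((n + 1 : ℕ) : ℝ) ^ 2) := by
        push_cast
        gcongr
        linarith [(Nat.cast_nonneg n : (0 : ℝ) ≤ n)]

end Lanczos

end KrylovJoint

/-! ### Gaussian anti-concentration and polar coordinates -/

namespace KrylovJoint

open MeasureTheory ProbabilityTheory
open scoped ENNReal

theorem pi_gaussianReal_eq_withDensity (ι : Type*) [Fintype ι] :
    Measure.pi (fun _ : ι => gaussianReal 0 1) =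
      (volume : Measure (ι → ℝ)).withDensity
        (fun x => ENNReal.ofReal (∏ i, gaussianPDFReal 0 1 (x i))) := by
  refine Measure.pi_eq fun s hs => ?_
  rw [withDensity_apply _ (MeasurableSet.univ_pi hs), volume_pi, Measure.restrict_pi_pi,
    ← ofReal_integral_eq_lintegral_ofReal, integral_fintype_prod_eq_prod,
    ENNReal.ofReal_prod_of_nonneg]
  · refine Finset.prod_congr rfl fun i _ => ?_
    rw [gaussianReal_apply_eq_integral 0 one_ne_zero]
  · exact fun i _ => integral_nonneg fun x => gaussianPDFReal_nonneg _ _ _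
  · exact Integrable.fintype_prod fun i => (integrable_gaussianPDFReal 0 1).restrict
  · exact Filter.Eventually.of_forall fun x =>
      Finset.prod_nonneg fun i _ => gaussianPDFReal_nonneg _ _ _

theorem integral_sq_gaussianReal : ∫ x, x ^ 2 ∂gaussianReal 0 1 = 1 := by
  have h := variance_fun_id_gaussianReal (μ := 0) (v := 1)
  rw [variance_of_integral_eq_zero aemeasurable_id' (by simp)] at h
  simpa using h

theorem integrable_sq_gaussianReal : Integrable (fun x : ℝ => x ^ 2) (gaussianReal 0 1) :=
  (memLp_id_gaussianReal 2).integrable_sq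

/-- The density is at most `1/√(2π) ≤ 1/2`, and the interval has length `2√ρ`. -/
theorem gaussianReal_sq_lt_le (ρ : ℝ) :
    gaussianReal 0 1 {a : ℝ | a ^ 2 < ρ} ≤ ENNReal.ofReal (√ρ) := by
  have hsub : {a : ℝ | a ^ 2 < ρ} ⊆ Set.Ioo (-√ρ) (√ρ) := by
    intro a ha
    exact abs_lt.1 (Real.lt_sqrt_of_sq_lt (by simpa using ha))
  refine (measure_mono hsub).trans ?_
  rw [gaussianReal_apply 0 one_ne_zero]
  have hpdf : ∀ x, gaussianPDF 0 1 x ≤ ENNReal.ofReal (1 / 2) := by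
    intro x
    refine ENNReal.ofReal_le_ofReal ?_
    rw [gaussianPDFReal]
    have h2 : (2 : ℝ) ≤ √(2 * Real.pi * (1 : NNReal)) := by
      apply Real.le_sqrt_of_sq_le
      have := Real.pi_gt_three
      norm_num
      linarith
    have h1 : Real.exp (-(x - 0) ^ 2 / (2 * (1 : NNReal))) ≤ 1 := by
      rw [Real.exp_le_one_iff]
      have := sq_nonneg (x - 0)
      rw [neg_div, neg_nonpos]
      positivity
    calc _ ≤ (2 : ℝ)⁻¹ * 1 := by gcongr
      _ = 1 / 2 := by norm_num
  calc ∫⁻ x in Set.Ioo (-√ρ) (√ρ), gaussianPDF 0 1 x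
      ≤ ∫⁻ _ in Set.Ioo (-√ρ) (√ρ), ENNReal.ofReal (1 / 2) := lintegral_mono fun x => hpdf x
    _ = ENNReal.ofReal (√ρ) := by
      rw [setLIntegral_const, Real.volume_Ioo, ← ENNReal.ofReal_mul (by norm_num)]
      congr 1
      ring

/-- A coordinate of a standard Gaussian vector in `ℝᵈ` is rarely smaller than `δ / √d` times the
Euclidean norm of the vector. -/
theorem pi_gaussianReal_coord_lt_le {d : ℕ} (i₀ : Fin d) {δ : ℝ} (hδ0 : 0 < δ) (hδ1 : δ < 1) :
    Measure.pi (fun _ : Fin d => gaussianReal 0 1)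
      {y | y i₀ ^ 2 < δ ^ 2 / d * ∑ i, y i ^ 2} ≤ ENNReal.ofReal δ := by
  obtain ⟨n, rfl⟩ : ∃ n, d = n + 1 := ⟨d - 1, by have := i₀.pos; omega⟩
  set q : ℝ := δ ^ 2 / ((n + 1 : ℕ) : ℝ) with hq
  have hn : (0 : ℝ) < ((n + 1 : ℕ) : ℝ) := by positivity
  have hδsq : δ ^ 2 < 1 := by nlinarith
  have hq1 : q < 1 := by
    rw [hq, div_lt_one hn]
    push_cast
    linarith [(Nat.cast_nonneg n : (0 : ℝ) ≤ n)]
  have hq0 : 0 < q := by positivity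
  have hqn : q / (1 - q) * n ≤ δ ^ 2 := by
    have h1 : q * ((n : ℝ) + 1) = δ ^ 2 := by rw [hq]; push_cast; field_simp
    rw [div_mul_eq_mul_div, div_le_iff₀ (by linarith)]
    have h2 : q * δ ^ 2 ≤ q * 1 := by gcongr
    linarith
  set T : Set (ℝ × (Fin n → ℝ)) := {p | p.1 ^ 2 < q / (1 - q) * ∑ i, p.2 i ^ 2} with hT
  have hTm : MeasurableSet T := measurableSet_lt (by fun_prop) (by fun_prop)
  -- Moving `y i₀ ^ 2` to the left isolates it from the other, independent coordinates.
  have hpre : {y : Fin (n + 1) → ℝ | y i₀ ^ 2 < q * ∑ i, y i ^ 2} =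
      MeasurableEquiv.piFinSuccAbove (fun _ => ℝ) i₀ ⁻¹' T := by
    ext y
    change y i₀ ^ 2 < q * ∑ i, y i ^ 2 ↔
      y i₀ ^ 2 < q / (1 - q) * ∑ i : Fin n, y (i₀.succAbove i) ^ 2
    rw [Fin.sum_univ_succAbove _ i₀, div_mul_eq_mul_div q, lt_div_iff₀ (by linarith)]
    constructor <;> intro h <;> linarith
  have hmp := measurePreserving_piFinSuccAbove (fun _ : Fin (n + 1) => gaussianReal 0 1) i₀
  rw [hpre, hmp.measure_preimage hTm.nullMeasurableSet, Measure.prod_apply_symm hTm]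
  set S : (Fin n → ℝ) → ℝ := fun y => ∑ i, y i ^ 2 with hS
  set γ := Measure.pi (fun _ : Fin n => gaussianReal 0 1) with hγ
  have hSint : Integrable S γ := integrable_finsetSum _ fun i _ =>
    integrable_comp_eval (μ := fun _ : Fin n => gaussianReal 0 1) (f := fun x => x ^ 2)
      integrable_sq_gaussianReal
  have hSval : ∫ y, S y ∂γ = n := by
    rw [hS, integral_finsetSum _ fun i _ =>
      integrable_comp_eval (μ := fun _ : Fin n => gaussianReal 0 1) (f := fun x => x ^ 2)
        integrable_sq_gaussianReal]
    have : ∀ i : Fin n, ∫ y, y i ^ 2 ∂γ = 1 := fun i => by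
      rw [hγ, integral_comp_eval (μ := fun _ : Fin n => gaussianReal 0 1) (f := fun x => x ^ 2)
        integrable_sq_gaussianReal.aestronglyMeasurable, integral_sq_gaussianReal]
    rw [Finset.sum_congr rfl fun i _ => this i]
    simp
  -- By AM-GM, `√r ≤ (δ + r/δ)/2`. This replaces the square root by an expression affine in `S`,
  -- whose mean is `n`; `hqn` then bounds the expectation by `δ`.
  have hint : Integrable (fun y => (δ + q / (1 - q) * S y / δ) / 2) γ := by fun_prop
  calc ∫⁻ y, gaussianReal 0 1 ((fun x => (x, y)) ⁻¹' T) ∂γ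
      ≤ ∫⁻ y, ENNReal.ofReal ((δ + q / (1 - q) * S y / δ) / 2) ∂γ := by
        refine lintegral_mono fun y => (gaussianReal_sq_lt_le (q / (1 - q) * S y)).trans
          (ENNReal.ofReal_le_ofReal ?_)
        have hnn : 0 ≤ q / (1 - q) * S y := by
          have : 0 < 1 - q := by linarith
          have : 0 ≤ S y := Finset.sum_nonneg fun i _ => sq_nonneg _
          positivity
        refine Real.sqrt_le_iff.2 ⟨by positivity, ?_⟩
        have e : ((δ + q / (1 - q) * S y / δ) / 2) ^ 2 =
            q / (1 - q) * S y + ((δ - q / (1 - q) * S y / δ) / 2) ^ 2 := by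
          field_simp
          ring
        rw [e]
        exact le_add_of_nonneg_right (sq_nonneg _)
    _ = ENNReal.ofReal ((δ + q / (1 - q) * n / δ) / 2) := by
        rw [← ofReal_integral_eq_lintegral_ofReal hint]
        · rw [integral_div, integral_add (integrable_const _) (by fun_prop), integral_div,
            integral_const_mul, hSval]
          simp
        · refine Filter.Eventually.of_forall fun y => ?_
          have : 0 < 1 - q := by linarith
          have : 0 ≤ S y := Finset.sum_nonneg fun i _ => sq_nonneg _
          simp only [Pi.zero_apply]
          positivity
    _ ≤ ENNReal.ofReal δ := by
        refine ENNReal.ofReal_le_ofReal ?_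
        have : q / (1 - q) * n / δ ≤ δ := by
          rw [div_le_iff₀ hδ0]
          linarith
        linarith

/-- Integrating a radial function over the cone spanned by a subset of the sphere. -/
theorem setLIntegral_cone_radial {E : Type*} [NormedAddCommGroup E] [NormedSpace ℝ E]
    [MeasurableSpace E] [BorelSpace E] [FiniteDimensional ℝ E] (μ : Measure E)
    [μ.IsAddHaarMeasure] {h : ℝ → ℝ≥0∞} (hh : Measurable h) {C : Set E} (hC : MeasurableSet C)
    {S : Set (Metric.sphere (0 : E) 1)} (hS : MeasurableSet S)
    (hCS : ∀ (s : Metric.sphere (0 : E) 1) (r : ℝ), 0 < r → (r • (s : E) ∈ C ↔ s ∈ S))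
    (hC0 : (0 : E) ∉ C) :
    ∫⁻ x in C, h ‖x‖ ∂μ = μ.toSphere S *
      ∫⁻ r, h r ∂Measure.volumeIoiPow (Module.finrank ℝ E - 1) := by
  have hmp := μ.measurePreserving_homeomorphUnitSphereProd
  have hsymm := hmp.symm (homeomorphUnitSphereProd E).toMeasurableEquiv
  have hsub : C ⊆ {0}ᶜ := fun x hx hx0 => hC0 (by rwa [Set.mem_singleton_iff.1 hx0] at hx)
  rw [← lintegral_indicator hC]
  have h1 : ∫⁻ x, C.indicator (fun x => h ‖x‖) x ∂μ =
      ∫⁻ x : ({0}ᶜ : Set E), C.indicator (fun x => h ‖x‖) (x : E) ∂(μ.comap (↑)) := by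
    rw [lintegral_subtype_comap (measurableSet_singleton _).compl,
      setLIntegral_indicator hC, Set.inter_eq_left.2 hsub, lintegral_indicator hC]
  rw [h1, ← hsymm.lintegral_comp (f := fun x => C.indicator (fun x => h ‖x‖) (x : E))
    (((hh.comp measurable_norm).indicator hC).comp measurable_subtype_coe)]
  have h2 : ∀ p : Metric.sphere (0 : E) 1 × Set.Ioi (0 : ℝ),
      C.indicator (fun x => h ‖x‖) (((homeomorphUnitSphereProd E).symm p : ({0}ᶜ : Set E)) : E) =
        S.indicator 1 p.1 * h p.2 := by
    rintro ⟨s, r⟩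
    rw [homeomorphUnitSphereProd_symm_apply_coe]
    have hr : (0 : ℝ) < r := r.2
    by_cases hs : s ∈ S
    · rw [Set.indicator_of_mem ((hCS s r hr).2 hs), Set.indicator_of_mem hs]
      simp [norm_smul, abs_of_pos hr]
    · rw [Set.indicator_of_notMem (fun hm => hs ((hCS s r hr).1 hm)), Set.indicator_of_notMem hs,
        zero_mul]
  calc _ = ∫⁻ p : Metric.sphere (0 : E) 1 × Set.Ioi (0 : ℝ), S.indicator 1 p.1 * h p.2
        ∂(μ.toSphere.prod (Measure.volumeIoiPow (Module.finrank ℝ E - 1))) :=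
        lintegral_congr fun p => h2 p
    _ = _ := by
        rw [lintegral_prod_mul (f := S.indicator 1) (g := fun r : Set.Ioi (0 : ℝ) => h r)
          (measurable_one.indicator hS).aemeasurable
          (hh.comp measurable_subtype_coe).aemeasurable, lintegral_indicator_one hS]

end KrylovJoint

/-! ### From the Gaussian to the uniform distribution on the sphere -/

namespace KrylovJoint

open MeasureTheory ProbabilityTheory
open scoped ENNReal

theorem setLIntegral_gaussian_eq_pi {d : ℕ}
    (v : OrthonormalBasis (Fin d) ℝ (EuclideanSpace ℝ (Fin d))) {D : Set (Fin d → ℝ)}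
    (hD : MeasurableSet D) :
    ∫⁻ x in {x | (fun i => inner ℝ (v i) x) ∈ D},
      ENNReal.ofReal ((√(2 * Real.pi))⁻¹ ^ d * Real.exp (-‖x‖ ^ 2 / 2)) =
      Measure.pi (fun _ : Fin d => gaussianReal 0 1) D := by
  have hmp : MeasurePreserving (fun x : EuclideanSpace ℝ (Fin d) => fun i => inner ℝ (v i) x)
      volume volume := by
    have h := (PiLp.volume_preserving_ofLp (Fin d)).comp v.measurePreserving_repr
    have e : (WithLp.ofLp ∘ v.repr : EuclideanSpace ℝ (Fin d) → Fin d → ℝ) =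
        fun x => fun i => inner ℝ (v i) x := by
      funext x i
      exact v.repr_apply_apply x i
    rwa [e] at h
  rw [pi_gaussianReal_eq_withDensity, withDensity_apply _ hD,
    ← hmp.setLIntegral_comp_preimage hD]
  · refine lintegral_congr fun x => ?_
    congr 1
    simp only [gaussianPDFReal, Finset.prod_mul_distrib, ← Real.exp_sum, Finset.prod_const,
      Finset.card_univ, Fintype.card_fin, NNReal.coe_one, mul_one, sub_zero]
    rw [norm_sq_eq_sum v, ← Finset.sum_div, Finset.sum_neg_distrib]
  · refine Measurable.ennreal_ofReal (Finset.measurable_prod _ fun i _ => ?_)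
    exact (measurable_gaussianPDFReal 0 1).comp (measurable_pi_apply i)

/-- A uniformly distributed unit vector of `ℝᵈ` rarely has a coordinate smaller than `δ / √d`. -/
theorem uniformSphere_inner_sq_lt_le {d : ℕ}
    (v : OrthonormalBasis (Fin d) ℝ (EuclideanSpace ℝ (Fin d))) (i₀ : Fin d) {δ : ℝ}
    (hδ0 : 0 < δ) (hδ1 : δ < 1) :
    uniformSphere d {s | inner ℝ (v i₀) (s : EuclideanSpace ℝ (Fin d)) ^ 2 < δ ^ 2 / d} ≤
      ENNReal.ofReal δ := by
  have : Nontrivial (EuclideanSpace ℝ (Fin d)) := ⟨⟨v i₀, 0, v.orthonormal.ne_zero i₀⟩⟩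
  set σ := (volume : Measure (EuclideanSpace ℝ (Fin d))).toSphere with hσ
  set S : Set (Metric.sphere (0 : EuclideanSpace ℝ (Fin d)) 1) :=
    {s | inner ℝ (v i₀) (s : EuclideanSpace ℝ (Fin d)) ^ 2 < δ ^ 2 / d} with hS
  set h : ℝ → ℝ≥0∞ :=
    fun r => ENNReal.ofReal ((√(2 * Real.pi))⁻¹ ^ d * Real.exp (-r ^ 2 / 2)) with hh
  have hhm : Measurable h := by fun_prop
  set I := ∫⁻ r, h r ∂Measure.volumeIoiPow (Module.finrank ℝ (EuclideanSpace ℝ (Fin d)) - 1)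
    with hI
  have hSm : MeasurableSet S := measurableSet_lt (by fun_prop) (by fun_prop)
  -- The Gaussian event is homogeneous, so it is the cone over `S`; its probability splits into `σ
  -- S` times the radial integral `I`. The whole space gives the normalization `σ univ * I = 1`.
  have h1 : σ S * I ≤ ENNReal.ofReal δ := by
    have hDm : MeasurableSet {y : Fin d → ℝ | y i₀ ^ 2 < δ ^ 2 / d * ∑ i, y i ^ 2} :=
      measurableSet_lt (by fun_prop) (by fun_prop)
    refine le_of_eq_of_le ?_ (pi_gaussianReal_coord_lt_le i₀ hδ0 hδ1)
    rw [← setLIntegral_gaussian_eq_pi v hDm]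
    refine (setLIntegral_cone_radial volume hhm ?_ hSm ?_ ?_).symm
    · exact hDm.preimage (by fun_prop)
    · intro s r hr
      change inner ℝ (v i₀) (r • (s : EuclideanSpace ℝ (Fin d))) ^ 2 <
        δ ^ 2 / d * ∑ i, inner ℝ (v i) (r • (s : EuclideanSpace ℝ (Fin d))) ^ 2 ↔
        inner ℝ (v i₀) (s : EuclideanSpace ℝ (Fin d)) ^ 2 < δ ^ 2 / d
      rw [← norm_sq_eq_sum v, norm_smul, inner_smul_right, norm_eq_of_mem_sphere, mul_one,
        mul_pow, Real.norm_eq_abs, sq_abs, mul_comm]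
      exact mul_lt_mul_iff_left₀ (by positivity)
    · change ¬ (inner ℝ (v i₀) (0 : EuclideanSpace ℝ (Fin d)) ^ 2 <
        δ ^ 2 / d * ∑ i, inner ℝ (v i) (0 : EuclideanSpace ℝ (Fin d)) ^ 2)
      simp
  have h2 : σ Set.univ * I = 1 := by
    rw [← setLIntegral_cone_radial volume hhm (C := {0}ᶜ) (measurableSet_singleton _).compl
      MeasurableSet.univ ?_ (by simp), restrict_compl_singleton]
    · have h3 := setLIntegral_gaussian_eq_pi v MeasurableSet.univ
      rw [measure_univ] at h3
      simpa only [Set.mem_univ, Set.ofPred_true, Measure.restrict_univ] using h3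
    · intro s r hr
      simp [hr.ne', ne_zero_of_mem_unit_sphere s]
  have h3 : σ Set.univ ≠ 0 := fun h0 => by simp [h0] at h2
  have h4 : (σ Set.univ)⁻¹ = I := (ENNReal.eq_inv_of_mul_eq_one_left
    (by rwa [mul_comm] at h2)).symm
  change (σ Set.univ)⁻¹ • σ S ≤ _
  rwa [h4, smul_eq_mul, mul_comm]

/-! ### Trust-region error bound -/

/-- From a point of a centred ball the sphere can be reached along a unit vector, in a direction
of prescribed sign. -/
theorem exists_reach_sphere {V : Type*} [NormedAddCommGroup V] [InnerProductSpace ℝ V] {y z : V}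
    {R : ℝ} (hy : ‖y‖ ≤ R) (hz : ‖z‖ = 1) (g : ℝ) :
    ∃ τ : ℝ, τ * g ≤ 0 ∧ ‖y + τ • z‖ = R ∧ |τ| ≤ 2 * R := by
  have hR : 0 ≤ R := (norm_nonneg y).trans hy
  set p : ℝ := inner ℝ y z with hp
  have hyR : ‖y‖ ^ 2 ≤ R ^ 2 := by gcongr
  set q : ℝ := √(p ^ 2 + (R ^ 2 - ‖y‖ ^ 2)) with hq
  have hq2 : q ^ 2 = p ^ 2 + (R ^ 2 - ‖y‖ ^ 2) :=
    Real.sq_sqrt (by linarith [sq_nonneg p])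
  have hpq : |p| ≤ q := Real.abs_le_sqrt (by linarith)
  have hroot : ∀ τ : ℝ, (τ + p) ^ 2 = q ^ 2 → ‖y + τ • z‖ = R := by
    intro τ hτ
    have h1 : ‖y + τ • z‖ ^ 2 = R ^ 2 := by
      rw [norm_add_sq_real, inner_smul_right, norm_smul, hz, mul_one, Real.norm_eq_abs, sq_abs,
        ← hp]
      linarith
    exact (pow_left_inj₀ (norm_nonneg _) hR two_ne_zero).1 h1
  have habs : ∀ τ : ℝ, ‖y + τ • z‖ = R → |τ| ≤ 2 * R := by
    intro τ hτ
    have h1 : ‖τ • z‖ = |τ| := by rw [norm_smul, hz, mul_one, Real.norm_eq_abs]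
    have h2 : τ • z = (y + τ • z) - y := by abel
    rw [← h1, h2]
    exact (norm_sub_le _ _).trans (by linarith)
  -- The line meets the sphere at `τ = -p ± q`, and `|p| ≤ q` makes one root nonpositive and the
  -- other nonnegative.
  obtain ⟨hl, hu⟩ := abs_le.1 hpq
  rcases le_total 0 g with hg | hg
  · have h := hroot (-p - q) (by ring)
    exact ⟨-p - q, mul_nonpos_of_nonpos_of_nonneg (by linarith) hg, h, habs _ h⟩
  · have h := hroot (-p + q) (by ring)
    exact ⟨-p + q, mul_nonpos_of_nonneg_of_nonpos (by linarith) hg, h, habs _ h⟩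

theorem exists_trustRegion_point {d : ℕ} {A : Matrix (Fin d) (Fin d) ℝ} (hA : A.IsHermitian)
    (b : EuclideanSpace ℝ (Fin d)) {u s : EuclideanSpace ℝ (Fin d)} (hu : ‖u‖ = 1) {R δ L : ℝ}
    (hδ0 : 0 < δ) {i₀ : Fin d} (hi₀ : hA.eigenvalues i₀ = lamMin hA)
    (hui : δ ^ 2 / d ≤ inner ℝ (hA.eigenvectorBasis i₀) u ^ 2)
    (hL0 : 0 < L) (hL : lamMax hA - lamMin hA ≤ L)
    (hs : IsArgmin (quadObj A b) {y | ‖y‖ ≤ R} s) {t : ℕ} (ht : 1 ≤ t) :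
    ∃ x ∈ jointKrylov A b u t, ‖x‖ ≤ R ∧
      quadObj A b x - quadObj A b s ≤ L * R ^ 2 / (t : ℝ) ^ 2 * logFactor hA δ := by
  obtain ⟨hsR, hsmin⟩ := hs
  change ‖s‖ ≤ R at hsR
  replace hsmin : ∀ y, ‖y‖ ≤ R → quadObj A b s ≤ quadObj A b y := hsmin
  have hR : 0 ≤ R := (norm_nonneg s).trans hsR
  have ht0 : (0 : ℝ) < t := by exact_mod_cast ht
  have hd : (0 : ℝ) < d := by exact_mod_cast i₀.pos
  set v := hA.eigenvectorBasis with hv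
  set l := lamMin hA with hl
  set H : EuclideanSpace ℝ (Fin d) →ₗ[ℝ] EuclideanSpace ℝ (Fin d) :=
    A.toEuclideanLin - l • LinearMap.id with hHdef
  have hHapply : ∀ x, H x = A.toEuclideanLin x - l • x := fun x => rfl
  have hAsymm : A.toEuclideanLin.IsSymmetric := Matrix.isSymmetric_toEuclideanLin_iff.2 hA
  have hH : H.IsSymmetric := by
    intro x y
    rw [hHapply, hHapply, inner_sub_left, inner_sub_right, hAsymm x y, inner_smul_left,
      inner_smul_right]
    simp
  have hμ : ∀ i, H (v i) = (hA.eigenvalues i - l) • v i := by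
    intro i
    have h1 : A.toEuclideanLin (v i) = hA.eigenvalues i • v i := by
      ext j
      exact congrFun (hA.mulVec_eigenvectorBasis i) j
    rw [hHapply, h1, sub_smul]
  have hμ0 : ∀ i, 0 ≤ hA.eigenvalues i - l := fun i =>
    sub_nonneg.2 (ciInf_le (Set.finite_range _).bddBelow i)
  have hμL : ∀ i, hA.eigenvalues i - l ≤ L := fun i =>
    (sub_le_sub_right (le_ciSup (Set.finite_range _).bddAbove i) l).trans hL
  have hH0 : ∀ x, 0 ≤ inner ℝ x (H x) := by
    intro x
    rw [inner_apply_eq_sum v hH hμ]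
    exact Finset.sum_nonneg fun i _ => mul_nonneg (hμ0 i) (sq_nonneg _)
  have hHL : ∀ x, inner ℝ x (H x) ≤ L * ‖x‖ ^ 2 := by
    intro x
    rw [inner_apply_eq_sum v hH hμ, norm_sq_eq_sum v, Finset.mul_sum]
    exact Finset.sum_le_sum fun i _ => mul_le_mul_of_nonneg_right (hμL i) (sq_nonneg _)
  have hquad : ∀ x, quadObj A b x = opQuad H b x + l / 2 * ‖x‖ ^ 2 := by
    intro x
    rw [quadObj, opQuad, hHapply, inner_sub_right, inner_smul_right, real_inner_self_eq_norm_sq]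
    ring
  have hKmono : ∀ k, jointKrylov A b u k ≤ jointKrylov A b u (k + 1) := fun k =>
    jointKrylov_mono A b u k.le_succ
  have hKH : ∀ k, ∀ x ∈ jointKrylov A b u k, H x ∈ jointKrylov A b u (k + 1) := by
    intro k x hx
    rw [hHapply]
    exact sub_mem (toEuclideanLin_mem_jointKrylov A b u k hx)
      (Submodule.smul_mem _ _ (hKmono k hx))
  have haccel : ∀ c : ℝ, 0 ≤ c → (∀ x, ‖x‖ ≤ R →
      opQuad H b s + c / 2 * ‖s‖ ^ 2 ≤ opQuad H b x + c / 2 * ‖x‖ ^ 2) →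
      ∃ x ∈ jointKrylov A b u t, ‖x‖ ≤ R ∧
        opQuad H b x + c / 2 * ‖x‖ ^ 2 - (opQuad H b s + c / 2 * ‖s‖ ^ 2) ≤
          L * R ^ 2 / (t : ℝ) ^ 2 * 4 := by
    intro c hc hmin
    obtain ⟨x, hx, z, -, hxR, -, h⟩ := exists_accelerated_iterate hH hH0 hHL hL0 hc hR b s _
      hKmono (left_mem_jointKrylov A b u) hKH hsR hmin t
    refine ⟨x, hx, hxR, ?_⟩
    set e := opQuad H b x + c / 2 * ‖x‖ ^ 2 - (opQuad H b s + c / 2 * ‖s‖ ^ 2) with he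
    have he0 : 0 ≤ e := sub_nonneg.2 (hmin x hxR)
    have h1 : (t : ℝ) ^ 2 / 4 * e ≤ L * R ^ 2 := by
      have h2 : (t : ℝ) ^ 2 / 4 * e ≤ (t : ℝ) * (t + 2) / 4 * e :=
        mul_le_mul_of_nonneg_right (by linarith) he0
      have h3 : L * ‖s‖ ^ 2 ≤ L * R ^ 2 := by gcongr
      have h4 : 0 ≤ L / 2 * ‖s - z‖ ^ 2 := by positivity
      have h5 : 0 ≤ L * ‖s‖ ^ 2 := by positivity
      linarith
    rw [div_mul_eq_mul_div, le_div_iff₀ (by positivity)]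
    linarith
  rcases le_or_gt 0 l with hl0 | hl0
  · obtain ⟨x, hx, hxR, h⟩ := haccel l hl0 fun x hx => by
      rw [← hquad, ← hquad]
      exact hsmin x hx
    refine ⟨x, hx, hxR, ?_⟩
    rw [← hquad, ← hquad] at h
    simpa [logFactor, ← hl, not_lt.2 hl0] using h
  · have hHv : H (v i₀) = 0 := by rw [hμ, hi₀, sub_self, zero_smul]
    -- Moving `y` along `±v i₀` to the sphere leaves the `H`-part unchanged and does not increase
    -- the linear part. On the sphere the concave term `l/2 ‖·‖²` is at its minimum over the ball.
    have hmin : ∀ y, ‖y‖ ≤ R → opQuad H b s ≤ opQuad H b y := by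
      intro y hy
      obtain ⟨τ, hτ, hτR, -⟩ := exists_reach_sphere hy (v.orthonormal.1 i₀) (inner ℝ b (v i₀))
      have h1 := hsmin _ hτR.le
      rw [hquad, hquad, hτR, opQuad_add hH, map_smul, hHv, smul_zero, inner_zero_right,
        inner_add_left, inner_smul_right, inner_smul_right, hH, hHv, inner_zero_right] at h1
      have h2 : l / 2 * R ^ 2 ≤ l / 2 * ‖s‖ ^ 2 := by
        have : ‖s‖ ^ 2 ≤ R ^ 2 := by gcongr
        exact mul_le_mul_of_nonpos_left this (by linarith)
      linarith
    obtain ⟨y, hy, hyR, he⟩ := haccel 0 le_rfl fun x hx => by simpa using hmin x hx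
    obtain ⟨z, hz, hz1, hzq⟩ := exists_small_rayleigh v hH hμ hL0 hμL
      (i₀ := i₀) (by rw [hi₀, sub_self]) hu (κ := δ ^ 2 / d) (by positivity) hui _ hKmono
      (right_mem_jointKrylov A b u 0) hKH ht
    obtain ⟨τ, hτ, hτR, hτabs⟩ := exists_reach_sphere hyR hz1 (inner ℝ (H y + b) z)
    refine ⟨y + τ • z, add_mem hy (Submodule.smul_mem _ _ hz), hτR.le, ?_⟩
    rw [hquad, hquad, hτR, opQuad_add hH, map_smul, inner_smul_left, inner_smul_right,
      inner_smul_right]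
    have h2 : l / 2 * R ^ 2 ≤ l / 2 * ‖s‖ ^ 2 := by
      have : ‖s‖ ^ 2 ≤ R ^ 2 := by gcongr
      exact mul_le_mul_of_nonpos_left this (by linarith)
    -- Second-order cost of the move to the sphere; the first-order cost is nonpositive by `hτ`.
    -- With `|τ| ≤ 2R` this is exactly the logarithmic term of `logFactor`.
    have h3 : 1 / 2 * (τ * (τ * inner ℝ z (H z))) ≤
        1 / 2 * ((2 * R) ^ 2 * (L * Real.log (4 / (δ ^ 2 / d)) ^ 2 / (4 * t ^ 2))) := by
      have h4 : τ ^ 2 ≤ (2 * R) ^ 2 := by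
        rw [← sq_abs τ]
        gcongr
      rw [← mul_assoc τ τ, ← sq]
      have := hH0 z
      gcongr
    have h5 : (4 : ℝ) / (δ ^ 2 / d) = 4 * d / δ ^ 2 := by field_simp
    rw [h5] at h3
    have h6 : L * R ^ 2 / (t : ℝ) ^ 2 * logFactor hA δ = L * R ^ 2 / (t : ℝ) ^ 2 * 4 +
        1 / 2 * ((2 * R) ^ 2 * (L * Real.log (4 * d / δ ^ 2) ^ 2 / (4 * t ^ 2))) := by
      rw [logFactor, ← hl, if_pos hl0]
      field_simp
      ring
    rw [h6]
    simp only [zero_div, zero_mul, add_zero] at he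
    simp only [conj_trivial]
    linarith

/-- The spectral gap vanishes when `A` is scalar, whereas acceleration needs `L > 0`; so `L` is the
gap plus `η`, and `η → 0`. Bounding a number `m` below all the errors keeps the limit free of the
`η`-dependent point and serves both problems. -/
theorem quadObj_sub_le_of_isArgmin {d : ℕ} {A : Matrix (Fin d) (Fin d) ℝ} (hA : A.IsHermitian)
    (b : EuclideanSpace ℝ (Fin d)) {u s : EuclideanSpace ℝ (Fin d)} (hu : ‖u‖ = 1) {R δ : ℝ}
    (hδ0 : 0 < δ) {i₀ : Fin d} (hi₀ : hA.eigenvalues i₀ = lamMin hA)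
    (hui : δ ^ 2 / d ≤ inner ℝ (hA.eigenvectorBasis i₀) u ^ 2)
    (hs : IsArgmin (quadObj A b) {y | ‖y‖ ≤ R} s) {t : ℕ} (ht : 1 ≤ t) {m : ℝ}
    (hm : ∀ x ∈ jointKrylov A b u t, ‖x‖ ≤ R → m ≤ quadObj A b x - quadObj A b s) :
    m ≤ (lamMax hA - lamMin hA) * R ^ 2 / (t : ℝ) ^ 2 * logFactor hA δ := by
  have hgap : 0 ≤ lamMax hA - lamMin hA := sub_nonneg.2
    ((ciInf_le (Set.finite_range _).bddBelow i₀).trans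
      (le_ciSup (Set.finite_range hA.eigenvalues).bddAbove i₀))
  have hle : ∀ η : ℝ, 0 < η →
      m ≤ (lamMax hA - lamMin hA + η) * R ^ 2 / (t : ℝ) ^ 2 * logFactor hA δ := by
    intro η hη
    obtain ⟨x, hx, hxR, h⟩ := exists_trustRegion_point hA b hu hδ0 hi₀ hui
      (by positivity : 0 < lamMax hA - lamMin hA + η) (by linarith) hs ht
    exact (hm x hx hxR).trans h
  have hcont : Continuous fun η : ℝ =>
      (lamMax hA - lamMin hA + η) * R ^ 2 / (t : ℝ) ^ 2 * logFactor hA δ := by fun_prop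
  have hlim := (hcont.tendsto 0).mono_left (nhdsWithin_le_nhds (s := Set.Ioi 0))
  rw [add_zero] at hlim
  exact ge_of_tendsto hlim (Filter.eventually_of_mem self_mem_nhdsWithin hle)

end KrylovJoint

/-! ### The probabilistic statement for both problems -/

theorem corollary5p2 {d : ℕ} (hd : 1 ≤ d)
    {A : Matrix (Fin d) (Fin d) ℝ} (hA : A.IsHermitian) (b : EuclideanSpace ℝ (Fin d))
    (R ρ : ℝ) (hR : 0 ≤ R) (hρ : 0 ≤ ρ) (δ : ℝ) (hδ0 : 0 < δ) (hδ1 : δ < 1)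
    {Ω : Type*} [MeasurableSpace Ω] (P : MeasureTheory.Measure Ω)
    [MeasureTheory.IsProbabilityMeasure P]
    (u : Ω → Metric.sphere (0 : EuclideanSpace ℝ (Fin d)) 1)
    (hu : ProbabilityTheory.HasLaw u (KrylovJoint.uniformSphere d) P) :
    ∃ E : Set Ω, MeasurableSet E ∧ ENNReal.ofReal (1 - δ) ≤ P E ∧
      ∀ ω ∈ E, ∀ t : ℕ, 1 ≤ t →
        (∀ s x : EuclideanSpace ℝ (Fin d),
          KrylovJoint.IsArgmin (KrylovJoint.quadObj A b) {y | ‖y‖ ≤ R} s →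
          KrylovJoint.IsArgmin (KrylovJoint.quadObj A b)
            {y | y ∈ KrylovJoint.jointKrylov A b (u ω) t ∧ ‖y‖ ≤ R} x →
          KrylovJoint.quadObj A b x - KrylovJoint.quadObj A b s ≤
            (KrylovJoint.lamMax hA - KrylovJoint.lamMin hA) * R ^ 2 / (t : ℝ) ^ 2 *
              KrylovJoint.logFactor hA δ) ∧
        (∀ s x : EuclideanSpace ℝ (Fin d),
          KrylovJoint.IsArgmin (KrylovJoint.cubicObj A b ρ) Set.univ s →
          KrylovJoint.IsArgmin (KrylovJoint.cubicObj A b ρ)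
            {y | y ∈ KrylovJoint.jointKrylov A b (u ω) t} x →
          KrylovJoint.cubicObj A b ρ x - KrylovJoint.cubicObj A b ρ s ≤
            (KrylovJoint.lamMax hA - KrylovJoint.lamMin hA) * ‖s‖ ^ 2 / (t : ℝ) ^ 2 *
              KrylovJoint.logFactor hA δ) := by
  have : Nonempty (Fin d) := ⟨⟨0, hd⟩⟩
  obtain ⟨i₀, hi₀⟩ := exists_eq_ciInf_of_finite (f := hA.eigenvalues)
  set B : Set (Metric.sphere (0 : EuclideanSpace ℝ (Fin d)) 1) :=
    {s | inner ℝ (hA.eigenvectorBasis i₀) (s : EuclideanSpace ℝ (Fin d)) ^ 2 < δ ^ 2 / d} with hB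
  have hBm : MeasurableSet B := measurableSet_lt (by fun_prop) (by fun_prop)
  have hPB : P (u ⁻¹' B) ≤ ENNReal.ofReal δ := by
    rw [← MeasureTheory.Measure.map_apply_of_aemeasurable hu.aemeasurable hBm, hu.map_eq]
    exact KrylovJoint.uniformSphere_inner_sq_lt_le hA.eigenvectorBasis i₀ hδ0 hδ1
  have hnull : MeasureTheory.NullMeasurableSet (u ⁻¹' B) P :=
    hu.aemeasurable.nullMeasurableSet_preimage hBm
  -- `u` is only almost everywhere measurable, so the good event is shrunk to a measurable set of
  -- the same probability.
  obtain ⟨E, hEsub, hEm, hE⟩ := hnull.compl.exists_measurable_subset_ae_eq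
  refine ⟨E, hEm, ?_, fun ω hω t ht => ?_⟩
  · rw [MeasureTheory.measure_congr hE, MeasureTheory.prob_compl_eq_one_sub₀ hnull,
      ENNReal.ofReal_sub _ hδ0.le, ENNReal.ofReal_one]
    exact tsub_le_tsub_left hPB 1
  have hui : δ ^ 2 / d ≤
      inner ℝ (hA.eigenvectorBasis i₀) (u ω : EuclideanSpace ℝ (Fin d)) ^ 2 :=
    not_lt.1 (hEsub hω)
  have hu1 : ‖(u ω : EuclideanSpace ℝ (Fin d))‖ = 1 := norm_eq_of_mem_sphere (u ω)
  refine ⟨fun s x hs hx => ?_, fun s x hs hx => ?_⟩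
  · exact KrylovJoint.quadObj_sub_le_of_isArgmin hA b hu1 hδ0 hi₀ hui hs ht
      fun y hy hyR => sub_le_sub_right (hx.2 y ⟨hy, hyR⟩) _
  -- Inside the ball of radius `‖s‖` the cubic term is at most its value at `s`. Hence `s` solves
  -- that trust-region problem, and cubic errors there are at most quadratic ones.
  · have hcube : ∀ y : EuclideanSpace ℝ (Fin d), ‖y‖ ≤ ‖s‖ →
        ρ / 3 * ‖y‖ ^ 3 ≤ ρ / 3 * ‖s‖ ^ 3 := fun y hy => by gcongr
    have hs' : KrylovJoint.IsArgmin (KrylovJoint.quadObj A b) {y | ‖y‖ ≤ ‖s‖} s := by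
      refine ⟨le_refl ‖s‖, fun y hy => ?_⟩
      have h1 := hs.2 y (Set.mem_univ y)
      have h2 := hcube y hy
      simp only [KrylovJoint.cubicObj] at h1
      linarith
    refine KrylovJoint.quadObj_sub_le_of_isArgmin hA b hu1 hδ0 hi₀ hui hs' ht fun y hy hyR => ?_
    have h1 := hx.2 y hy
    have h2 := hcube y hyR
    simp only [KrylovJoint.cubicObj] at h1 ⊢
    linarith
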